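/- Let $X$ be a finite set and let $(X,\{R_0,\dots,R_d\})$ be a symmetric $d$-class association scheme: $R_0,\dots,R_d$ are nonempty symmetric relations partitioning $X\times X$, $R_0$ is the identity relation, and for all $i,j,k$ the number of $z$ with $(x,z)\in R_i$, $(z,y)\in R_j$ is the same for all $(x,y)\in R_k$. Let $A_0,\dots,A_d$ be the adjacency matrices of the relations, let $\mathbb{A}=\operatorname{span}_{\mathbb{R}}\{A_0,\dots,A_d\}$ be the Bose–Mesner algebra, and let $E_0=\frac1{|X|}J,E_1,\dots,E_d$ be an enumeration of its minimal idempotents, where $J$ is the all-ones matrix. Write $\circ$ for the entrywise (Schur) product. The Krein parameters $q_{ij}^k$ are defined by $E_i\circ E_j=\frac1{|X|}\sum_k q_{ij}^kE_k$, and $L_i^*$ is the $(d+1)\times(d+1)$ matrix with entry $q_{ij}^k$ in row $k$ and column $j$. The Gegenbauer polynomials in dimension $m$ are given by $Q_0^m(t)=1$, $Q_1^m(t)=t$ and $$Q_\ell^m(t)=\frac{(2\ell+m-4)\,t\,Q_{\ell-1}^m(t)-(\ell-1)\,Q_{\ell-2}^m(t)}{\ell+m-3}\qquad(\ell\ge 2);$$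 for a positive integer $m$, the polynomial $Q^m_\ell$ is defined if and only if $m\ge 2$ or $\ell\le 1$. Write $f\circ(M)$ for the matrix obtained by applying $f$ to each entry of $M$, and let $\langle M\rangle_\circ$ (the Schur subalgebra generated by $M$) be the span of all entrywise powers $M^{\circ n}$, $n\ge 0$, where $M^{\circ 0}=J$. Fix $0\le i\le d$ and let $m_i=\operatorname{rank}E_i$. (1) For every integer $\ell>0$ with $\ell=1$ or $m_i\ge2$ there exist non-negative real constants $\theta_{\ell j}$, $0\le j\le d$, such that $$Q_\ell^{m_i}\circ\Big(\frac{|X|}{m_i}E_i\Big)=\sum_j\theta_{\ell j}E_j\qquad\text{and}\qquad Q_\ell^{m_i}\Big(\frac1{m_i}L_i^*\Big)=\frac1{|X|}\sum_j\theta_{\ell j}L_j^*.$$ The set of eigenvalues of $Q_\ell^{m_i}\circ\big(\frac{|X|}{m_i}E_i\big)$ is $\{\theta_{\ell0},\dots,\theta_{\ell d}\}$. Moreover $\theta_{\ell j}\neq0$ only if $E_j$ occurs in the Schur subalgebra $\langle E_i\rangle_\circ$, that is, $E_j$ has a nonzero coefficient in the expansion of some element of $\langle E_i\rangle_\circ$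 in the basis $E_0,\dots,E_d$; and only if $j$ belongs to every index set $T\ni i$ for which $\operatorname{span}\{E_t:t\in T\}$ is closed under the Schur product. (2) Consequently, for every integer $\ell\ge0$ with $\ell\le1$ or $m_i\ge2$, every entry of $Q_\ell^{m_i}\big(\frac1{m_i}L_i^*\big)$ is non-negative. -/

import Mathlib

open Polynomial Matrix

/-- A symmetric `d`-class association scheme on the finite set `X`: nonempty relations
`R 0, …, R d` partitioning `X × X`, with `R 0` the identity relation, all symmetric, and such that
for `(x, y) ∈ R k` the number of `z` with `(x, z) ∈ R i` and `(z, y) ∈ R j` depends only on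
`i, j, k`. -/
structure SymmetricAssociationScheme (X : Type*) [Fintype X] (d : ℕ) where
  R : Fin (d + 1) → X → X → Prop
  nonempty : ∀ i, ∃ x y, R i x y
  zero_iff : ∀ x y, R 0 x y ↔ x = y
  partition : ∀ x y, ∃! i, R i x y
  symm : ∀ i x y, R i x y → R i y x
  intersection : ∀ i j k, ∃ p : ℕ, ∀ x y, R k x y → Nat.card {z // R i x z ∧ R j z y} = p

namespace SymmetricAssociationScheme

variable {X : Type*} [Fintype X] {d : ℕ}

open Classical in
/-- The adjacency matrix `A i` of the relation `R i`. -/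
noncomputable def adj (S : SymmetricAssociationScheme X d) (i : Fin (d + 1)) : Matrix X X ℝ :=
  Matrix.of fun x y => if S.R i x y then 1 else 0

/-- The Bose–Mesner algebra, as the real span of the adjacency matrices. -/
noncomputable def boseMesner (S : SymmetricAssociationScheme X d) :
    Submodule ℝ (Matrix X X ℝ) :=
  Submodule.span ℝ (Set.range S.adj)

/-- Minimal (primitive) idempotents of the Bose–Mesner algebra, for the matrix product. -/
def IsMinimalIdempotent (S : SymmetricAssociationScheme X d) (E : Matrix X X ℝ) : Prop :=
  E ∈ S.boseMesner ∧ E * E = E ∧ E ≠ 0 ∧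
    ∀ F ∈ S.boseMesner, F * F = F → E * F = F → F = 0 ∨ F = E

/-- An enumeration `E 0, …, E d` without repetition of all the minimal idempotents of the
Bose–Mesner algebra, with `E 0 = (1 / |X|) J` by convention. -/
structure IdempotentEnumeration (S : SymmetricAssociationScheme X d) where
  E : Fin (d + 1) → Matrix X X ℝ
  minimal : ∀ j, S.IsMinimalIdempotent (E j)
  injective : Function.Injective E
  exhaustive : ∀ F, S.IsMinimalIdempotent F → ∃ j, E j = F
  zero_eq : E 0 = (1 / (Fintype.card X : ℝ)) • Matrix.of fun _ _ => 1

variable (S : SymmetricAssociationScheme X d)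

lemma adj_mem (i : Fin (d + 1)) : S.adj i ∈ S.boseMesner :=
  Submodule.subset_span ⟨i, rfl⟩

lemma transpose_of_mem {M : Matrix X X ℝ} (hM : M ∈ S.boseMesner) : Mᵀ = M := by
  classical
  induction hM using Submodule.span_induction with
  | mem x hx =>
    obtain ⟨i, rfl⟩ := hx
    ext x y
    simp only [adj, Matrix.transpose_apply, Matrix.of_apply]
    have h : S.R i y x ↔ S.R i x y := ⟨S.symm i y x, S.symm i x y⟩
    simp only [h]
  | zero => simp
  | add x y _ _ hx hy => rw [Matrix.transpose_add, hx, hy]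
  | smul a x _ hx => rw [Matrix.transpose_smul, hx]

lemma adj_mul_adj_mem (i j : Fin (d + 1)) : S.adj i * S.adj j ∈ S.boseMesner := by
  classical
  choose p hp using S.intersection i j
  have h : S.adj i * S.adj j = ∑ k, (p k : ℝ) • S.adj k := by
    ext x y
    obtain ⟨k, hk, huniq⟩ := S.partition x y
    have h1 : (S.adj i * S.adj j) x y = (p k : ℝ) := by
      rw [← hp k x y hk, Nat.card_eq_fintype_card, Fintype.card_subtype]
      simp only [Matrix.mul_apply, adj, Matrix.of_apply, ← ite_and, mul_ite, mul_one, mul_zero]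
      rw [Finset.sum_ite, Finset.sum_const_zero, add_zero, Finset.sum_const, nsmul_eq_mul, mul_one]
      congr 2
      ext z
      simp [and_comm]
    rw [h1, Matrix.sum_apply, Finset.sum_eq_single k]
    · simp [adj, hk]
    · intro l _ hl
      have : ¬ S.R l x y := fun h => hl (huniq l h)
      simp [adj, this]
    · simp
  rw [h]
  exact Submodule.sum_mem _ fun k _ => Submodule.smul_mem _ _ (S.adj_mem k)

lemma mul_mem {M N : Matrix X X ℝ} (hM : M ∈ S.boseMesner) (hN : N ∈ S.boseMesner) :
    M * N ∈ S.boseMesner := by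
  induction hM using Submodule.span_induction with
  | mem x hx =>
    obtain ⟨i, rfl⟩ := hx
    induction hN using Submodule.span_induction with
    | mem y hy => obtain ⟨j, rfl⟩ := hy; exact S.adj_mul_adj_mem i j
    | zero => simp
    | add x y _ _ hx hy => rw [Matrix.mul_add]; exact Submodule.add_mem _ hx hy
    | smul a x _ hx => rw [Matrix.mul_smul]; exact Submodule.smul_mem _ _ hx
  | zero => simp
  | add x y _ _ hx hy => rw [Matrix.add_mul]; exact Submodule.add_mem _ hx hy
  | smul a x _ hx => rw [Matrix.smul_mul]; exact Submodule.smul_mem _ _ hx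

lemma mul_comm_of_mem {M N : Matrix X X ℝ} (hM : M ∈ S.boseMesner) (hN : N ∈ S.boseMesner) :
    M * N = N * M := by
  have h := S.transpose_of_mem (S.mul_mem hM hN)
  rw [Matrix.transpose_mul, S.transpose_of_mem hM, S.transpose_of_mem hN] at h
  exact h.symm

lemma adj_hadamard_adj_mem (i j : Fin (d + 1)) : S.adj i ⊙ S.adj j ∈ S.boseMesner := by
  by_cases hij : i = j
  · subst hij
    have : S.adj i ⊙ S.adj i = S.adj i := by
      ext x y
      simp [adj, Matrix.hadamard_apply]
    rw [this]
    exact S.adj_mem i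
  · have : S.adj i ⊙ S.adj j = 0 := by
      ext x y
      by_cases hi : S.R i x y
      · have hj : ¬ S.R j x y := fun hj => hij ((S.partition x y).unique hi hj)
        simp [adj, Matrix.hadamard_apply, hj]
      · simp [adj, Matrix.hadamard_apply, hi]
    rw [this]
    exact Submodule.zero_mem _

/-- The Bose–Mesner algebra is closed under the Schur (entrywise) product. -/
lemma hadamard_mem {M N : Matrix X X ℝ} (hM : M ∈ S.boseMesner) (hN : N ∈ S.boseMesner) :
    M ⊙ N ∈ S.boseMesner := by
  induction hM using Submodule.span_induction with
  | mem x hx =>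
    obtain ⟨i, rfl⟩ := hx
    induction hN using Submodule.span_induction with
    | mem y hy => obtain ⟨j, rfl⟩ := hy; exact S.adj_hadamard_adj_mem i j
    | zero => simp
    | add x y _ _ hx hy => rw [Matrix.hadamard_add]; exact Submodule.add_mem _ hx hy
    | smul a x _ hx => rw [Matrix.hadamard_smul]; exact Submodule.smul_mem _ _ hx
  | zero => simp
  | add x y _ _ hx hy => rw [Matrix.add_hadamard]; exact Submodule.add_mem _ hx hy
  | smul a x _ hx => rw [Matrix.smul_hadamard]; exact Submodule.smul_mem _ _ hx

lemma IsMinimalIdempotent.mul_eq_zero {S : SymmetricAssociationScheme X d} {E F : Matrix X X ℝ}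
    (hE : S.IsMinimalIdempotent E) (hF : S.IsMinimalIdempotent F) (hne : E ≠ F) : E * F = 0 := by
  obtain ⟨hEm, hEE, -, hEmin⟩ := hE
  obtain ⟨hFm, hFF, -, hFmin⟩ := hF
  have hc := S.mul_comm_of_mem hEm hFm
  have hm := S.mul_mem hEm hFm
  have hE' : E * (E * F) = E * F := by rw [← Matrix.mul_assoc, hEE]
  have hF' : F * (E * F) = E * F := by rw [hc, ← Matrix.mul_assoc, hFF]
  have hi : (E * F) * (E * F) = E * F := by rw [Matrix.mul_assoc, hF', hE']
  rcases hEmin _ hm hi hE' with h | h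
  · exact h
  · rcases hFmin _ hm hi hF' with h' | h'
    · exact h'
    · exact absurd (h.symm.trans h') hne

namespace IdempotentEnumeration

variable {S} (e : S.IdempotentEnumeration)

/-- The minimal idempotents, as elements of the Bose–Mesner algebra. -/
def elem (j : Fin (d + 1)) : S.boseMesner := ⟨e.E j, (e.minimal j).1⟩

lemma linearIndependent_elem : LinearIndependent ℝ e.elem := by
  rw [Fintype.linearIndependent_iff]
  intro g hg i
  have h : ∑ j, g j • e.E j = 0 := by
    have := congrArg (Subtype.val) hg
    simpa [elem] using this
  have h2 : g i • e.E i = 0 := by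
    have h3 := congrArg (fun M => e.E i * M) h
    simp only [Matrix.mul_sum, Matrix.mul_smul, Matrix.mul_zero] at h3
    rw [Finset.sum_eq_single i] at h3
    · rwa [(e.minimal i).2.1] at h3
    · intro j _ hj
      rw [(e.minimal i).mul_eq_zero (e.minimal j) fun h => hj (e.injective h).symm, smul_zero]
    · simp
  exact (smul_eq_zero.mp h2).resolve_right (e.minimal i).2.2.1

lemma card_eq_finrank (e : S.IdempotentEnumeration) :
    Fintype.card (Fin (d + 1)) = Module.finrank ℝ S.boseMesner :=
  le_antisymm (LinearIndependent.fintype_card_le_finrank e.linearIndependent_elem) (finrank_range_le_card S.adj)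

/-- The basis of minimal idempotents of the Bose–Mesner algebra. -/
noncomputable def basis : Module.Basis (Fin (d + 1)) ℝ S.boseMesner :=
  basisOfLinearIndependentOfCardEqFinrank e.linearIndependent_elem e.card_eq_finrank

/-- The multiplicity `m i`, the rank of `E i`. -/
noncomputable def mult (i : Fin (d + 1)) : ℕ := (e.E i).rank

/-- The Krein parameter `q i j k` (usually written `q_{ij}^k`): the coefficient of `E k` in
`|X| (E i ∘ E j)`. -/
noncomputable def krein (i j k : Fin (d + 1)) : ℝ :=
  Fintype.card X *
    e.basis.repr ⟨e.E i ⊙ e.E j, S.hadamard_mem (e.minimal i).1 (e.minimal j).1⟩ k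

/-- The defining property of the Krein parameters. -/
lemma hadamard_eq_sum_krein [Nonempty X] (i j : Fin (d + 1)) :
    e.E i ⊙ e.E j = (1 / (Fintype.card X : ℝ)) • ∑ k, e.krein i j k • e.E k := by
  have h := congrArg Subtype.val (e.basis.sum_repr
    ⟨e.E i ⊙ e.E j, S.hadamard_mem (e.minimal i).1 (e.minimal j).1⟩)
  have hX : (Fintype.card X : ℝ) ≠ 0 := by exact_mod_cast Fintype.card_ne_zero
  simp only [Submodule.coe_sum, Submodule.coe_smul, basis,
    coe_basisOfLinearIndependentOfCardEqFinrank, elem] at h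
  simp only [krein, Finset.smul_sum, smul_smul, basis, ← mul_assoc, one_div,
    inv_mul_cancel₀ hX, one_mul]
  exact h.symm

/-- The array of Krein parameters `L i`, whose entry in row `k` and column `j` is `q_{ij}^k`. -/
noncomputable def kreinArray (i : Fin (d + 1)) : Matrix (Fin (d + 1)) (Fin (d + 1)) ℝ :=
  Matrix.of fun k j => e.krein i j k

end IdempotentEnumeration

end SymmetricAssociationScheme

/-- The Gegenbauer polynomial of degree `ℓ` in dimension `m`, normalised to take the value `1` at
`1`. All denominators are nonzero when `2 ≤ m` or `ℓ ≤ 1`; for `m = 1` the recurrence breaks down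
at `ℓ = 2`. -/
noncomputable def gegenbauer (m : ℕ) : ℕ → ℝ[X]
  | 0 => 1
  | 1 => Polynomial.X
  | (n + 2) =>
    let ℓ : ℝ := (n : ℝ) + 2
    C (1 / (ℓ + m - 3)) *
      (C (2 * ℓ + m - 4) * Polynomial.X * gegenbauer m (n + 1) - C (ℓ - 1) * gegenbauer m n)

/-- The Schur subalgebra generated by `M`: linear combinations of the Schur (entrywise) powers
of `M`, the zeroth power being the all-ones matrix. -/
def schurSubalgebra {X : Type*} (M : Matrix X X ℝ) : Submodule ℝ (Matrix X X ℝ) :=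
  Submodule.span ℝ (Set.range fun n : ℕ => M.map fun t => t ^ n)

/-! Put m = m_i. A symmetric idempotent of rank m is a Gram matrix in dimension m. Its diagonal is
constant and its trace is m, so (|X|/m)E_i is a Gram matrix of unit vectors in ℝ^m. By Schoenberg's
theorem (`posSemidef_gegenbauer`), applying Q_ℓ entrywise keeps it positive semidefinite. The result
stays in the Bose–Mesner algebra, which is Schur-closed. Its coefficients in the E_j are therefore
its eigenvalues, all non-negative.

Schur multiplication, written in the basis of the E_j, turns Schur products into matrix products and
sends E_i to L_i^*/|X| (`represents_E`). This carries the expansion over to the Krein arrays. Part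
(2) follows because Krein parameters are themselves non-negative, by the Schur product theorem.

Schoenberg's theorem is proved by realising Q_ℓ(y·z), up to a positive constant, as the Fischer
inner product of the zonal harmonics with poles y and z. -/

namespace MvPolynomial

/-! ### The Fischer pairing. -/

variable {σ : Type*}

/-- The Fischer pairing `∑ α, α! p_α q_α` of real multivariate polynomials. -/
noncomputable def fischer :
    MvPolynomial σ ℝ →ₗ[ℝ] MvPolynomial σ ℝ →ₗ[ℝ] ℝ :=
  (basisMonomials σ ℝ).constr ℝ fun α =>
    ((α.prod fun _ k => (k.factorial : ℝ)) : ℝ) • lcoeff ℝ α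

lemma fischer_monomial (α : σ →₀ ℕ) (a : ℝ) (q : MvPolynomial σ ℝ) :
    fischer (monomial α a) q = a * ((α.prod fun _ k => (k.factorial : ℝ)) * coeff α q) := by
  have h : monomial α a = a • basisMonomials σ ℝ α := by
    simp [coe_basisMonomials, smul_monomial]
  rw [h, map_smul, fischer, Module.Basis.constr_basis]
  simp [lcoeff]

lemma fischer_self_nonneg (p : MvPolynomial σ ℝ) : 0 ≤ fischer p p := by
  have h : fischer p p = ∑ α ∈ p.support, fischer (monomial α (coeff α p)) p := by
    rw [← LinearMap.sum_apply, ← map_sum, ← p.as_sum]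
  rw [h]
  refine Finset.sum_nonneg fun α _ => ?_
  rw [fischer_monomial]
  have : 0 ≤ α.prod fun _ k => (k.factorial : ℝ) :=
    Finset.prod_nonneg fun _ _ => Nat.cast_nonneg _
  nlinarith [mul_nonneg this (mul_self_nonneg (coeff α p))]

/-- Multiplication by a variable is adjoint to the partial derivative for the Fischer pairing. -/
lemma fischer_X_mul (i : σ) (p q : MvPolynomial σ ℝ) :
    fischer (X i * p) q = fischer p (pderiv i q) := by
  classical
  induction p using MvPolynomial.induction_on' with
  | add p q hp hq => simp only [mul_add, map_add, LinearMap.add_apply, hp, hq]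
  | monomial α a =>
    induction q using MvPolynomial.induction_on' with
    | add p q hp hq => simp only [map_add, hp, hq]
    | monomial β b =>
      have hX : X i * monomial α a = monomial (α + Finsupp.single i 1) a := by
        rw [X, monomial_mul, one_mul, add_comm]
      have hfac : ((α + Finsupp.single i 1).prod fun _ k => (k.factorial : ℝ)) =
          (α i + 1) * α.prod fun _ k => (k.factorial : ℝ) := by
        -- Isolating the factor at i over a common index set leaves the same remaining product for α
        -- and α + e_i.
        have h1 : ∀ γ : σ →₀ ℕ, γ.support ⊆ insert i α.support →
            (γ.prod fun _ k => (k.factorial : ℝ)) =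
              (γ i).factorial * ∏ j ∈ α.support.erase i, ((γ j).factorial : ℝ) := by
          intro γ hγ
          rw [Finsupp.prod_of_support_subset γ hγ _ (by simp),
            ← Finset.mul_prod_erase _ _ (Finset.mem_insert_self i _),
            Finset.erase_insert_eq_erase]
        rw [h1 α (Finset.subset_insert _ _), h1]
        · have h2 : ∏ j ∈ α.support.erase i, (((α + Finsupp.single i 1 : σ →₀ ℕ) j).factorial : ℝ) =
              ∏ j ∈ α.support.erase i, ((α j).factorial : ℝ) := by
            refine Finset.prod_congr rfl fun j hj => ?_
            have : i ≠ j := (Finset.ne_of_mem_erase hj).symm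
            simp [this]
          rw [h2]
          simp [Nat.factorial_succ, mul_assoc]
        · intro j hj
          by_cases h : i = j
          · simp [h]
          · simp_all
      rw [hX, fischer_monomial, fischer_monomial, pderiv_monomial, coeff_monomial,
        coeff_monomial, hfac]
      by_cases h : β = α + Finsupp.single i 1
      · subst h
        rw [if_pos rfl, if_pos (by simp)]
        simp only [Finsupp.add_apply, Finsupp.single_eq_same]
        push_cast
        ring
      · rw [if_neg h]
        -- Subtraction is truncated, so equality can hold here with β i = 0; the factor β i in the
        -- derivative then vanishes.
        by_cases h2 : β - Finsupp.single i 1 = α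
        · have h3 : β i = 0 := by
            by_contra h0
            refine h ?_
            rw [← h2, tsub_add_cancel_of_le]
            exact Finsupp.single_le_iff.2 (Nat.one_le_iff_ne_zero.2 h0)
          simp [h3]
        · simp [h2]

/-! ### Directional derivatives, the Laplacian and their Fischer adjoints. -/

variable [Fintype σ]

/-- The linear form `∑ i, y i * X i`. -/
noncomputable def linForm (y : σ → ℝ) : MvPolynomial σ ℝ := ∑ i, C (y i) * X i

/-- The derivative in the direction `y`. -/
noncomputable def dirDeriv (y : σ → ℝ) :
    Derivation ℝ (MvPolynomial σ ℝ) (MvPolynomial σ ℝ) :=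
  mkDerivation ℝ fun i => C (y i)

lemma dirDeriv_apply (y : σ → ℝ) (p : MvPolynomial σ ℝ) :
    dirDeriv y p = ∑ i, C (y i) * pderiv i p := by
  classical
  have h : dirDeriv y = ∑ i, y i • pderiv (R := ℝ) i := by
    refine derivation_ext fun j => ?_
    have : ∀ s : Finset σ, (∑ i ∈ s, y i • pderiv (R := ℝ) i) (X j) =
        ∑ i ∈ s, y i • pderiv (R := ℝ) i (X j) := by
      intro s
      induction s using Finset.induction_on with
      | empty => simp
      | insert a s ha ih => simp [Finset.sum_insert ha, ih]
    rw [this]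
    simp [dirDeriv, mkDerivation_X, pderiv_X, Pi.single_apply, smul_eq_C_mul]
  have : ∀ s : Finset σ, (∑ i ∈ s, y i • pderiv (R := ℝ) i) p =
      ∑ i ∈ s, y i • pderiv (R := ℝ) i p := by
    intro s
    induction s using Finset.induction_on with
    | empty => simp
    | insert a s ha ih => simp [Finset.sum_insert ha, ih]
  rw [h, this]
  simp [smul_eq_C_mul]

variable (σ) in
/-- The squared norm `∑ i, X i ^ 2`. -/
noncomputable def normSq : MvPolynomial σ ℝ := ∑ i, X i * X i

/-- The Laplacian `∑ i, ∂ᵢ²`. -/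
noncomputable def laplacian : MvPolynomial σ ℝ →ₗ[ℝ] MvPolynomial σ ℝ :=
  ∑ i, (pderiv i).toLinearMap ∘ₗ (pderiv i).toLinearMap

lemma laplacian_apply (p : MvPolynomial σ ℝ) : laplacian p = ∑ i, pderiv i (pderiv i p) := by
  simp [laplacian, LinearMap.sum_apply]

lemma fischer_linForm_mul (y : σ → ℝ) (p q : MvPolynomial σ ℝ) :
    fischer (linForm y * p) q = fischer p (dirDeriv y q) := by
  simp only [linForm, Finset.sum_mul, map_sum, LinearMap.sum_apply, dirDeriv_apply, C_mul',
    smul_mul_assoc, map_smul, LinearMap.smul_apply, fischer_X_mul]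

lemma fischer_normSq_mul (p q : MvPolynomial σ ℝ) :
    fischer (normSq σ * p) q = fischer p (laplacian q) := by
  simp only [normSq, Finset.sum_mul, map_sum, LinearMap.sum_apply, laplacian_apply,
    mul_assoc, fischer_X_mul]

lemma IsHomogeneous.dirDeriv {q : MvPolynomial σ ℝ} {n : ℕ} (hq : q.IsHomogeneous n)
    (y : σ → ℝ) : (dirDeriv y q).IsHomogeneous (n - 1) := by
  rw [dirDeriv_apply]
  refine IsHomogeneous.sum _ _ _ fun i _ => ?_
  simpa using (isHomogeneous_C σ (y i)).mul (hq.pderiv (i := i))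

lemma IsHomogeneous.eval_dirDeriv_self {q : MvPolynomial σ ℝ} {n : ℕ} (hq : q.IsHomogeneous n)
    (y : σ → ℝ) : eval y (MvPolynomial.dirDeriv y q) = n * eval y q := by
  have h := congrArg (eval y) hq.sum_X_mul_pderiv
  simpa [dirDeriv_apply] using h

/-- The reproducing property: each factor of the linear form moves across as a derivative along y,
and Euler's identity at y contributes the degree each time. -/
lemma IsHomogeneous.fischer_linForm_pow {q : MvPolynomial σ ℝ} {n : ℕ}
    (hq : q.IsHomogeneous n) (y : σ → ℝ) :
    fischer (linForm y ^ n) q = n.factorial * eval y q := by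
  induction n generalizing q with
  | zero =>
    have h1 : (1 : MvPolynomial σ ℝ) = monomial 0 1 := rfl
    have h2 : q = C (coeff 0 q) :=
      totalDegree_eq_zero_iff_eq_C.1 ((totalDegree_zero_iff_isHomogeneous σ).2 hq)
    rw [pow_zero, h1, fischer_monomial, h2]
    simp
  | succ n ih =>
    have h := hq.dirDeriv y
    rw [Nat.add_sub_cancel] at h
    rw [pow_succ', fischer_linForm_mul, ih h, hq.eval_dirDeriv_self, Nat.factorial_succ]
    push_cast
    ring

lemma pderiv_linForm (y : σ → ℝ) (i : σ) : pderiv i (linForm y) = C (y i) := by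
  classical
  simp [linForm, map_sum, Derivation.leibniz, pderiv_X, Pi.single_apply]

lemma pderiv_normSq (i : σ) : pderiv i (normSq σ) = 2 * (X i : MvPolynomial σ ℝ) := by
  classical
  simp [normSq, map_sum, Derivation.leibniz, pderiv_X, Pi.single_apply, Finset.sum_add_distrib]
  ring

lemma laplacian_mul (p q : MvPolynomial σ ℝ) :
    laplacian (p * q) =
      p * laplacian q + 2 * ∑ i, pderiv i p * pderiv i q + q * laplacian p := by
  simp only [laplacian_apply, Finset.mul_sum, ← Finset.sum_add_distrib]
  refine Finset.sum_congr rfl fun i _ => ?_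
  simp only [Derivation.leibniz, map_add, smul_eq_mul]
  ring

lemma laplacian_linForm_mul (y : σ → ℝ) (q : MvPolynomial σ ℝ) :
    laplacian (linForm y * q) = linForm y * laplacian q + 2 * dirDeriv y q := by
  have : laplacian (linForm y) = 0 := by simp [laplacian_apply, pderiv_linForm]
  rw [laplacian_mul, this, dirDeriv_apply]
  simp [pderiv_linForm]

lemma IsHomogeneous.laplacian_normSq_mul {q : MvPolynomial σ ℝ} {n : ℕ}
    (hq : q.IsHomogeneous n) :
    laplacian (normSq σ * q) =
      normSq σ * laplacian q + (2 * (Fintype.card σ : MvPolynomial σ ℝ) + 4 * n) * q := by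
  have h1 : laplacian (normSq σ) = 2 * (Fintype.card σ : MvPolynomial σ ℝ) := by
    have h2 : ∀ i : σ, pderiv i (2 * (X i : MvPolynomial σ ℝ)) = 2 := by
      intro i
      have : (2 * (X i : MvPolynomial σ ℝ)) = X i + X i := two_mul _
      rw [this, map_add, pderiv_X_self]
      norm_num
    simp only [laplacian_apply, pderiv_normSq, h2]
    simp [mul_comm]
  have h3 : ∑ i, pderiv i (normSq σ) * pderiv i q = 2 * (n * q) := by
    rw [← nsmul_eq_mul, ← hq.sum_X_mul_pderiv, Finset.mul_sum]
    exact Finset.sum_congr rfl fun i _ => by rw [pderiv_normSq]; ring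
  rw [laplacian_mul, h1, h3]
  ring

/-! ### Zonal harmonics. -/

/-- The zonal harmonic of degree `ℓ` with pole `y`: the homogenization of the Gegenbauer
polynomial in dimension `|σ|` along the linear form of `y`. -/
noncomputable def zonal (y : σ → ℝ) : ℕ → MvPolynomial σ ℝ
  | 0 => 1
  | 1 => linForm y
  | (n + 2) =>
    C (1 / ((n : ℝ) + Fintype.card σ - 1)) *
      (((2 * n + Fintype.card σ : ℕ) : MvPolynomial σ ℝ) * linForm y * zonal y (n + 1) -
        ((n + 1 : ℕ) : MvPolynomial σ ℝ) * normSq σ * zonal y n)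

lemma natCast_add_card_sub_one_ne_zero (R : Type*) [Ring R] [CharZero R]
    (hσ : 2 ≤ Fintype.card σ) (n : ℕ) : (n : R) + Fintype.card σ - 1 ≠ 0 := by
  obtain ⟨k, hk⟩ := Nat.exists_eq_add_of_le hσ
  have : (n : R) + Fintype.card σ - 1 = ((n + k : ℕ) : R) + 1 := by
    rw [hk]; push_cast; rw [← one_add_one_eq_two]; abel
  rw [this]
  exact Nat.cast_add_one_ne_zero _

lemma zonal_rec (hσ : 2 ≤ Fintype.card σ) (y : σ → ℝ) (n : ℕ) :
    ((n : MvPolynomial σ ℝ) + Fintype.card σ - 1) * zonal y (n + 2) =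
      (2 * n + Fintype.card σ) * linForm y * zonal y (n + 1) -
        (n + 1) * normSq σ * zonal y n := by
  have h : (n : MvPolynomial σ ℝ) + Fintype.card σ - 1 =
      (C ((n : ℝ) + Fintype.card σ - 1) : MvPolynomial σ ℝ) := by simp
  rw [h, zonal, ← mul_assoc, ← C_mul,
    mul_one_div_cancel (natCast_add_card_sub_one_ne_zero ℝ hσ n), C_1, one_mul]
  push_cast
  rfl

lemma linForm_isHomogeneous (y : σ → ℝ) : (linForm y).IsHomogeneous 1 :=
  IsHomogeneous.sum _ _ _ fun i _ => by
    simpa using (isHomogeneous_C σ (y i)).mul (isHomogeneous_X ℝ i)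

lemma normSq_isHomogeneous : (normSq σ).IsHomogeneous 2 :=
  IsHomogeneous.sum _ _ _ fun i _ => (isHomogeneous_X ℝ i).mul (isHomogeneous_X ℝ i)

lemma zonal_isHomogeneous (y : σ → ℝ) : ∀ n, (zonal y n).IsHomogeneous n
  | 0 => isHomogeneous_one _ _
  | 1 => linForm_isHomogeneous y
  | (n + 2) => by
    have h1 : ∀ k : ℕ, (k : MvPolynomial σ ℝ).IsHomogeneous 0 := fun k => by
      simpa using isHomogeneous_C σ (k : ℝ)
    have h3 := ((h1 (2 * n + Fintype.card σ)).mul (linForm_isHomogeneous y)).mul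
      (zonal_isHomogeneous y (n + 1))
    have h4 := ((h1 (n + 1)).mul normSq_isHomogeneous).mul (zonal_isHomogeneous y n)
    rw [show 0 + 1 + (n + 1) = n + 2 by ring] at h3
    rw [show 0 + 2 + n = n + 2 by ring] at h4
    rw [zonal]
    simpa only [zero_add] using (isHomogeneous_C σ _).mul (h3.sub h4)

lemma dirDeriv_linForm_self {y : σ → ℝ} (hy : y ⬝ᵥ y = 1) : dirDeriv y (linForm y) = 1 := by
  simp only [dirDeriv_apply, pderiv_linForm, ← C_mul, ← map_sum]
  rw [← C_1, ← hy]; rfl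

lemma dirDeriv_normSq (y : σ → ℝ) : dirDeriv y (normSq σ) = 2 * linForm y := by
  simp only [dirDeriv_apply, pderiv_normSq, linForm, Finset.mul_sum]
  exact Finset.sum_congr rfl fun i _ => by ring

/-- Differentiate the three-term recurrence along the pole; the preceding instance of the recurrence
absorbs the surplus terms. This evaluates the cross term in `laplacian_zonal`. -/
lemma dirDeriv_zonal (hσ : 2 ≤ Fintype.card σ) {y : σ → ℝ} (hy : y ⬝ᵥ y = 1) :
    ∀ n, dirDeriv y (zonal y (n + 1)) = (n + 1) * zonal y n
  | 0 => by simp [zonal, dirDeriv_linForm_self hy]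
  | 1 => by
    have h := congrArg (dirDeriv y) (zonal_rec hσ y 0)
    have h0 := natCast_add_card_sub_one_ne_zero (MvPolynomial σ ℝ) hσ 0
    apply mul_left_cancel₀ h0
    simp only [zonal, Derivation.leibniz, map_add, map_sub, smul_eq_mul, Derivation.map_natCast,
      dirDeriv_linForm_self hy, dirDeriv_normSq, Derivation.map_one_eq_zero] at h ⊢
    push_cast at h ⊢
    linear_combination h
  | (n + 2) => by
    have h := congrArg (dirDeriv y) (zonal_rec hσ y (n + 1))
    have h0 := natCast_add_card_sub_one_ne_zero (MvPolynomial σ ℝ) hσ (n + 1)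
    have ih1 := dirDeriv_zonal hσ hy (n + 1)
    have ih2 := dirDeriv_zonal hσ hy n
    have hr := zonal_rec hσ y n
    apply mul_left_cancel₀ h0
    have h2 : dirDeriv y (2 : MvPolynomial σ ℝ) = 0 := by
      exact_mod_cast (dirDeriv y).map_natCast 2
    simp only [Derivation.leibniz, map_add, map_sub, smul_eq_mul, Derivation.map_natCast,
      dirDeriv_linForm_self hy, dirDeriv_normSq, Derivation.map_one_eq_zero, ih1, ih2, h2] at h ⊢
    push_cast at h ⊢
    linear_combination h - (n + 2) * hr

/-- Under the Laplacian, the recurrence leaves 2(2n + |σ|)(n + 1) times the n-th zonal from the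
linear form and (n + 1)(2|σ| + 4n) times it from the squared norm; these cancel. -/
lemma laplacian_zonal (hσ : 2 ≤ Fintype.card σ) {y : σ → ℝ} (hy : y ⬝ᵥ y = 1) :
    ∀ n, laplacian (zonal y n) = 0
  | 0 => by simp [zonal, laplacian_apply]
  | 1 => by simp [zonal, laplacian_apply, pderiv_linForm]
  | (n + 2) => by
    have h := congrArg laplacian (zonal_rec hσ y n)
    have h1 : ∀ (k : ℕ) (p : MvPolynomial σ ℝ), laplacian ((k : MvPolynomial σ ℝ) * p) = k * laplacian p := by
      intro k p
      rw [← nsmul_eq_mul, map_nsmul, nsmul_eq_mul]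
    have h2 : (2 * n + Fintype.card σ) * linForm y * zonal y (n + 1) -
        (n + 1) * normSq σ * zonal y n =
        ((2 * n + Fintype.card σ : ℕ) : MvPolynomial σ ℝ) * (linForm y * zonal y (n + 1)) -
        ((n + 1 : ℕ) : MvPolynomial σ ℝ) * (normSq σ * zonal y n) := by
      push_cast; ring
    have h3 : ((n : MvPolynomial σ ℝ) + Fintype.card σ - 1) * zonal y (n + 2) =
        ((n + Fintype.card σ : ℕ) : MvPolynomial σ ℝ) * zonal y (n + 2) - zonal y (n + 2) := by
      push_cast; ring
    rw [h2, h3, map_sub, map_sub, h1, h1, h1, laplacian_linForm_mul,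
      (zonal_isHomogeneous y n).laplacian_normSq_mul, laplacian_zonal hσ hy n,
      laplacian_zonal hσ hy (n + 1), dirDeriv_zonal hσ hy] at h
    apply mul_left_cancel₀ (natCast_add_card_sub_one_ne_zero (MvPolynomial σ ℝ) hσ n)
    push_cast at h
    linear_combination h

/-- Modulo `normSq`, a zonal harmonic is a positive multiple of a power of the linear form. -/
lemma exists_zonal_eq (hσ : 2 ≤ Fintype.card σ) (n : ℕ) : ∃ a : ℝ, 0 < a ∧ ∀ y : σ → ℝ,
    ∃ W, zonal y n = C a * linForm y ^ n + normSq σ * W := by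
  induction n with
  | zero => exact ⟨1, one_pos, fun y => ⟨0, by simp [zonal]⟩⟩
  | succ n ih =>
    cases n with
    | zero => exact ⟨1, one_pos, fun y => ⟨0, by simp [zonal]⟩⟩
    | succ n =>
      obtain ⟨a, ha, h⟩ := ih
      have h2 : (2 : ℝ) ≤ Fintype.card σ := by exact_mod_cast hσ
      have hn : (0 : ℝ) ≤ n := Nat.cast_nonneg n
      refine ⟨1 / ((n : ℝ) + Fintype.card σ - 1) * (2 * n + Fintype.card σ) * a, ?_, fun y => ?_⟩
      · have h3 : 0 < (n : ℝ) + Fintype.card σ - 1 := by linarith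
        have h4 : 0 < 2 * (n : ℝ) + Fintype.card σ := by linarith
        positivity
      · obtain ⟨W, hW⟩ := h y
        refine ⟨C (1 / ((n : ℝ) + Fintype.card σ - 1)) *
          (((2 * n + Fintype.card σ : ℕ) : MvPolynomial σ ℝ) * linForm y * W -
            ((n + 1 : ℕ) : MvPolynomial σ ℝ) * zonal y n), ?_⟩
        rw [zonal, hW]
        simp only [C_mul, C_add, map_natCast, map_ofNat]
        push_cast
        ring

lemma eval_linForm (y z : σ → ℝ) : eval z (linForm y) = y ⬝ᵥ z := by
  simp [linForm, dotProduct]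

lemma eval_zonal (y : σ → ℝ) {z : σ → ℝ} (hz : z ⬝ᵥ z = 1) : ∀ n,
    eval z (zonal y n) = (gegenbauer (Fintype.card σ) n).eval (y ⬝ᵥ z)
  | 0 => by simp [zonal, gegenbauer]
  | 1 => by simp [zonal, gegenbauer, eval_linForm]
  | (n + 2) => by
    have h : eval z (normSq σ) = 1 := by rw [← hz]; simp [normSq, dotProduct]
    have h1 : (n : ℝ) + 2 + Fintype.card σ - 3 = n + Fintype.card σ - 1 := by ring
    have h2 : 2 * ((n : ℝ) + 2) + Fintype.card σ - 4 = 2 * n + Fintype.card σ := by ring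
    have h3 : (n : ℝ) + 2 - 1 = n + 1 := by ring
    rw [zonal, gegenbauer]
    simp only [Polynomial.eval_mul, Polynomial.eval_sub, Polynomial.eval_C, Polynomial.eval_X]
    simp only [map_mul, map_sub, eval_C, map_natCast, eval_linForm, h, eval_zonal y hz n,
      eval_zonal y hz (n + 1), mul_one]
    rw [h1, h2, h3]
    push_cast
    rfl

/-! ### Schoenberg's theorem. -/

/-- Multiples of `normSq` are Fischer-orthogonal to harmonic polynomials, so only the power of the
linear form in `zonal y n` counts, and it evaluates `zonal z n` at y. -/
lemma exists_fischer_zonal (hσ : 2 ≤ Fintype.card σ) (n : ℕ) : ∃ c : ℝ, 0 < c ∧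
    ∀ y z : σ → ℝ, z ⬝ᵥ z = 1 → y ⬝ᵥ y = 1 →
      fischer (zonal y n) (zonal z n) = c * (gegenbauer (Fintype.card σ) n).eval (y ⬝ᵥ z) := by
  obtain ⟨a, ha, h⟩ := exists_zonal_eq hσ n
  refine ⟨a * n.factorial, by positivity, fun y z hz hy => ?_⟩
  obtain ⟨W, hW⟩ := h y
  rw [hW, map_add, LinearMap.add_apply, fischer_normSq_mul, laplacian_zonal hσ hz, C_mul',
    map_smul, LinearMap.smul_apply, (zonal_isHomogeneous z n).fischer_linForm_pow,
    eval_zonal z hy, dotProduct_comm z y]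
  simp [mul_assoc]

/-- Schoenberg's theorem: Gegenbauer polynomials in dimension `|σ|` preserve positive
semidefiniteness of Gram matrices of unit vectors of `ℝ^σ`. -/
theorem posSemidef_gegenbauer {ι : Type*} [Fintype ι] (hσ : 2 ≤ Fintype.card σ) (n : ℕ)
    (u : ι → σ → ℝ) (hu : ∀ x, u x ⬝ᵥ u x = 1) :
    (Matrix.of fun x y =>
      (gegenbauer (Fintype.card σ) n).eval (u x ⬝ᵥ u y)).PosSemidef := by
  obtain ⟨c, hc, h⟩ := exists_fischer_zonal hσ n
  rw [Matrix.posSemidef_iff_dotProduct_mulVec]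
  refine ⟨?_, fun v => ?_⟩
  · ext x y
    simp [dotProduct_comm]
  · have h1 := fischer_self_nonneg (∑ x, v x • zonal (u x) n)
    -- The quadratic form at v is, up to c, the Fischer square of the combination of zonals with
    -- coefficients v.
    have h2 : fischer (∑ x, v x • zonal (u x) n) (∑ x, v x • zonal (u x) n) =
        c * (star v ⬝ᵥ ((Matrix.of fun x y =>
          (gegenbauer (Fintype.card σ) n).eval (u x ⬝ᵥ u y)) *ᵥ v)) := by
      simp only [map_sum, LinearMap.sum_apply, map_smul, LinearMap.smul_apply, smul_eq_mul,
        dotProduct, mulVec, Matrix.of_apply, Finset.mul_sum, Pi.star_apply, star_trivial]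
      rw [Finset.sum_comm]
      refine Finset.sum_congr rfl fun x _ => Finset.sum_congr rfl fun y _ => ?_
      rw [h _ _ (hu y) (hu x)]
      simp only [dotProduct]
      ring
    rw [h2] at h1
    exact nonneg_of_mul_nonneg_right h1 hc

end MvPolynomial

/-! ### Gram factorisation of idempotents, and Schur subalgebras. -/

namespace Matrix

/-- A real symmetric idempotent matrix is the Gram matrix of vectors in dimension its rank. -/
lemma exists_gram_of_isIdempotent {ι : Type*} [Fintype ι] [DecidableEq ι] {E : Matrix ι ι ℝ}
    (hs : Eᵀ = E) (hE : E * E = E) :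
    ∃ B : Matrix ι (Fin E.rank) ℝ, B * Bᵀ = E ∧ Bᵀ * B = 1 := by
  -- E is the orthogonal projection onto V; the columns of B will be an orthonormal basis of V.
  let V := LinearMap.range (toEuclideanLin E)
  have hr : Module.finrank ℝ V = E.rank :=
    (E.rank_eq_finrank_range_toLin (PiLp.basisFun 2 ℝ ι) (PiLp.basisFun 2 ℝ ι)).symm ▸ rfl
  let b : OrthonormalBasis (Fin E.rank) ℝ V := (stdOrthonormalBasis ℝ V).reindex (finCongr hr)
  have hfix : ∀ v : V, toEuclideanLin E v = v := by
    rintro ⟨_, w, rfl⟩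
    ext x
    simp [toEuclideanLin, mulVec_mulVec, hE]
  have horth : ∀ k l, ∑ x, (b k : EuclideanSpace ℝ ι) x * (b l : EuclideanSpace ℝ ι) x =
      if k = l then 1 else 0 := by
    intro k l
    have h := orthonormal_iff_ite.1 b.orthonormal k l
    rw [← h, Submodule.coe_inner, PiLp.inner_apply]
    exact Finset.sum_congr rfl fun x _ => by simp [mul_comm]
  refine ⟨Matrix.of fun x k => (b k : EuclideanSpace ℝ ι) x, ?_, ?_⟩
  · ext x y
    let w : V := ⟨toEuclideanLin E (EuclideanSpace.single y 1), _, rfl⟩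
    -- By symmetry E moves from e_y onto b_k, which it fixes; so column y of E has coordinates
    -- b_k(y).
    have hw : ∀ k, inner ℝ (b k) w = (b k : EuclideanSpace ℝ ι) y := by
      intro k
      have h1 := congrArg (fun v : EuclideanSpace ℝ ι => v y) (hfix (b k))
      simp only [toEuclideanLin, toLpLin_apply] at h1
      rw [← h1, Submodule.coe_inner, PiLp.inner_apply]
      simp only [w, toEuclideanLin, mulVec, dotProduct, toLpLin_apply]
      refine Finset.sum_congr rfl fun x _ => ?_
      have h2 : E x y = E y x := congrFun (congrFun hs y) x
      simp [h2]
    have h := congrArg (fun v : V => (v : EuclideanSpace ℝ ι) x) (b.sum_repr' w)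
    simp only [hw] at h
    simp only [Submodule.coe_sum, Submodule.coe_smul, w, toEuclideanLin, toLpLin_apply] at h
    simp only [WithLp.ofLp_sum, WithLp.ofLp_smul, Finset.sum_apply, Pi.smul_apply, smul_eq_mul,
      PiLp.ofLp_single, mulVec_single_one, col_apply] at h
    rw [← h, mul_apply]
    exact Finset.sum_congr rfl fun k _ => mul_comm _ _
  · ext k l
    simp [mul_apply, horth, one_apply]

lemma map_eval_mem_schurSubalgebra {ι : Type*} (M : Matrix ι ι ℝ) (c : ℝ) (p : ℝ[X]) :
    (c • M).map (fun t => p.eval t) ∈ schurSubalgebra M := by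
  have h : (c • M).map (fun t => p.eval t) =
      ∑ n ∈ p.support, (p.coeff n * c ^ n) • M.map fun t => t ^ n := by
    ext x y
    simp [eval_eq_sum, Polynomial.sum, Matrix.sum_apply, mul_pow, mul_assoc]
  rw [h]
  exact Submodule.sum_mem _ fun n _ => Submodule.smul_mem _ _ (Submodule.subset_span ⟨n, rfl⟩)

lemma schurSubalgebra_le {ι : Type*} {M : Matrix ι ι ℝ} {W : Submodule ℝ (Matrix ι ι ℝ)}
    (hone : (Matrix.of fun _ _ => 1) ∈ W) (hM : M ∈ W)
    (hW : ∀ A ∈ W, ∀ B ∈ W, A ⊙ B ∈ W) : schurSubalgebra M ≤ W := by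
  refine Submodule.span_le.2 ?_
  rintro _ ⟨n, rfl⟩
  induction n with
  | zero =>
    simp only [pow_zero]
    exact hone
  | succ n ih =>
    have h : (M.map fun t => t ^ (n + 1)) = (M.map fun t => t ^ n) ⊙ M := by
      ext x y
      simp [pow_succ]
    simp only [h]
    exact hW _ ih _ hM

end Matrix

/-! ### Expansion in minimal idempotents. -/

namespace SymmetricAssociationScheme

variable {X : Type*} [Fintype X] {d : ℕ}

lemma nonempty_points (S : SymmetricAssociationScheme X d) : Nonempty X :=
  let ⟨x, _⟩ := S.nonempty 0; ⟨x⟩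

lemma one_mem (S : SymmetricAssociationScheme X d) [DecidableEq X] :
    (1 : Matrix X X ℝ) ∈ S.boseMesner := by
  have h : (1 : Matrix X X ℝ) = S.adj 0 := by
    ext x y
    simp [adj, S.zero_iff, one_apply]
  exact h ▸ S.adj_mem 0

lemma allOnes_mem (S : SymmetricAssociationScheme X d) :
    (Matrix.of fun _ _ => 1 : Matrix X X ℝ) ∈ S.boseMesner := by
  have h : (Matrix.of fun _ _ => 1 : Matrix X X ℝ) = ∑ i, S.adj i := by
    ext x y
    obtain ⟨k, hk, huniq⟩ := S.partition x y
    rw [Matrix.sum_apply, Finset.sum_eq_single k]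
    · simp [adj, hk]
    · intro l _ hl
      have : ¬ S.R l x y := fun h => hl (huniq l h)
      simp [adj, this]
    · simp
  exact h ▸ Submodule.sum_mem _ fun i _ => S.adj_mem i

lemma diag_eq_of_mem (S : SymmetricAssociationScheme X d) {M : Matrix X X ℝ}
    (hM : M ∈ S.boseMesner) (x y : X) : M x x = M y y := by
  induction hM using Submodule.span_induction with
  | mem M hM =>
    obtain ⟨i, rfl⟩ := hM
    have h : ∀ z, S.R i z z ↔ i = 0 := fun z =>
      ⟨fun h => (S.partition z z).unique h ((S.zero_iff z z).2 rfl),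
        fun h => h ▸ (S.zero_iff z z).2 rfl⟩
    simp [adj, h]
  | zero => simp
  | add A B _ _ hA hB => simp [hA, hB]
  | smul a A _ hA => simp [hA]

namespace IdempotentEnumeration

variable {S : SymmetricAssociationScheme X d} (e : S.IdempotentEnumeration)

lemma E_mul_sum (θ : Fin (d + 1) → ℝ) (j : Fin (d + 1)) :
    e.E j * ∑ k, θ k • e.E k = θ j • e.E j := by
  rw [Matrix.mul_sum, Finset.sum_eq_single j]
  · rw [Matrix.mul_smul, (e.minimal j).2.1]
  · intro k _ hk
    rw [Matrix.mul_smul, (e.minimal j).mul_eq_zero (e.minimal k)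
      fun h => hk (e.injective h).symm, smul_zero]
  · simp

lemma exists_eq_sum {M : Matrix X X ℝ} (hM : M ∈ S.boseMesner) :
    ∃ θ : Fin (d + 1) → ℝ, M = ∑ j, θ j • e.E j := by
  refine ⟨e.basis.repr ⟨M, hM⟩, ?_⟩
  have h := congrArg Subtype.val (e.basis.sum_repr ⟨M, hM⟩)
  simp only [Submodule.coe_sum, Submodule.coe_smul, basis,
    coe_basisOfLinearIndependentOfCardEqFinrank, elem] at h
  exact h.symm

lemma coeff_unique {a b : Fin (d + 1) → ℝ} (h : ∑ j, a j • e.E j = ∑ j, b j • e.E j) :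
    a = b := by
  funext j
  have h1 := congrArg (e.E j * ·) h
  simp only [E_mul_sum] at h1
  exact smul_left_injective ℝ (e.minimal j).2.2.1 h1

lemma sum_E [DecidableEq X] : ∑ j, e.E j = 1 := by
  obtain ⟨θ, hθ⟩ := e.exists_eq_sum S.one_mem
  have h : ∀ j, θ j = 1 := by
    intro j
    have h1 := e.E_mul_sum θ j
    rw [← hθ, Matrix.mul_one] at h1
    exact (smul_left_injective ℝ (e.minimal j).2.2.1
      (show (1 : ℝ) • e.E j = θ j • e.E j by rw [one_smul]; exact h1)).symm
  rw [hθ]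
  simp [h]

lemma transpose_E (j : Fin (d + 1)) : (e.E j)ᵀ = e.E j := S.transpose_of_mem (e.minimal j).1

lemma posSemidef_E (j : Fin (d + 1)) : (e.E j).PosSemidef := by
  have h := posSemidef_self_mul_conjTranspose (e.E j)
  rwa [conjTranspose_eq_transpose_of_trivial, e.transpose_E, (e.minimal j).2.1] at h

lemma exists_mulVec_eq_self (j : Fin (d + 1)) : ∃ v : X → ℝ, v ≠ 0 ∧ e.E j *ᵥ v = v := by
  classical
  obtain ⟨v, hv⟩ : ∃ v, e.E j *ᵥ v ≠ 0 := by
    by_contra! h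
    refine (e.minimal j).2.2.1 (Matrix.ext_of_mulVec_single fun y => ?_)
    rw [h, zero_mulVec]
  exact ⟨_, hv, by rw [mulVec_mulVec, (e.minimal j).2.1]⟩

lemma sum_mulVec (θ : Fin (d + 1) → ℝ) {j : Fin (d + 1)} {v : X → ℝ} (hv : e.E j *ᵥ v = v) :
    (∑ k, θ k • e.E k) *ᵥ v = θ j • v := by
  have hc : (∑ k, θ k • e.E k) * e.E j = θ j • e.E j := by
    rw [S.mul_comm_of_mem (Submodule.sum_mem _ fun k _ => Submodule.smul_mem _ _ (e.minimal k).1)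
      (e.minimal j).1, e.E_mul_sum]
  rw [← hv, mulVec_mulVec, hc, smul_mulVec]

/-- A nonzero vector fixed by E_j is an eigenvector with eigenvalue θ_j. -/
lemma coeff_nonneg {θ : Fin (d + 1) → ℝ} (h : (∑ k, θ k • e.E k).PosSemidef)
    (j : Fin (d + 1)) : 0 ≤ θ j := by
  obtain ⟨v, hv0, hv⟩ := e.exists_mulVec_eq_self j
  have h1 := h.dotProduct_mulVec_nonneg v
  rw [e.sum_mulVec θ hv, star_trivial, dotProduct_smul, smul_eq_mul] at h1
  have h2 : 0 < v ⬝ᵥ v := by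
    refine lt_of_le_of_ne ?_ (fun h => hv0 (dotProduct_self_eq_zero.1 h.symm))
    simpa using dotProduct_star_self_nonneg v
  exact nonneg_of_mul_nonneg_left h1 h2

lemma hasEigenvalue_sum_iff [DecidableEq X] (θ : Fin (d + 1) → ℝ) (μ : ℝ) :
    Module.End.HasEigenvalue (Matrix.toLin' (∑ k, θ k • e.E k)) μ ↔ ∃ j, θ j = μ := by
  constructor
  · intro h
    obtain ⟨v, hv⟩ := h.exists_hasEigenvector
    have h1 : (∑ k, θ k • e.E k) *ᵥ v = μ • v := hv.apply_eq_smul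
    by_contra! hne
    -- If μ differs from every θ_j, each E_j kills v, and so does their sum, the identity.
    refine hv.2 ?_
    have h2 : ∀ j, e.E j *ᵥ v = 0 := by
      intro j
      have h3 := congrArg (e.E j *ᵥ ·) h1
      simp only [mulVec_mulVec, E_mul_sum, mulVec_smul, smul_mulVec] at h3
      have h4 : (θ j - μ) • (e.E j *ᵥ v) = 0 := by rw [sub_smul, h3, sub_self]
      exact (smul_eq_zero.1 h4).resolve_left (sub_ne_zero.2 (hne j))
    rw [← one_mulVec v, ← e.sum_E, Matrix.sum_mulVec]
    exact Finset.sum_eq_zero fun j _ => h2 j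
  · rintro ⟨j, rfl⟩
    obtain ⟨v, hv0, hv⟩ := e.exists_mulVec_eq_self j
    exact Module.End.hasEigenvalue_of_hasEigenvector
      ⟨Module.End.mem_eigenspace_iff.2 (e.sum_mulVec θ hv), hv0⟩

lemma E_mul_eq_zero_of_mem_span {T : Set (Fin (d + 1))} {M : Matrix X X ℝ}
    (hM : M ∈ Submodule.span ℝ (e.E '' T)) {j : Fin (d + 1)} (hj : j ∉ T) : e.E j * M = 0 := by
  induction hM using Submodule.span_induction with
  | mem M hM =>
    obtain ⟨k, hk, rfl⟩ := hM
    exact (e.minimal j).mul_eq_zero (e.minimal k) fun h => hj (e.injective h ▸ hk)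
  | zero => simp
  | add A B _ _ hA hB => rw [Matrix.mul_add, hA, hB, add_zero]
  | smul a A _ hA => rw [Matrix.mul_smul, hA, smul_zero]

/-- A Schur-closed span of minimal idempotents contains the all-ones matrix. -/
lemma zero_mem_of_schur_closed {T : Set (Fin (d + 1))} {i : Fin (d + 1)} (hi : i ∈ T)
    (hT : ∀ M ∈ Submodule.span ℝ (e.E '' T), ∀ N ∈ Submodule.span ℝ (e.E '' T),
      M ⊙ N ∈ Submodule.span ℝ (e.E '' T)) : 0 ∈ T := by
  by_contra h0
  have := S.nonempty_points
  have hX : (Fintype.card X : ℝ) ≠ 0 := by exact_mod_cast Fintype.card_ne_zero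
  have hE := Submodule.subset_span (R := ℝ) (Set.mem_image_of_mem e.E hi)
  have h := e.E_mul_eq_zero_of_mem_span (hT _ hE _ hE) h0
  refine (e.minimal i).2.2.1 ?_
  ext x y
  have h1 := congrFun (congrFun h x) y
  simp only [e.zero_eq, Matrix.smul_apply, mul_apply, Matrix.of_apply, hadamard_apply,
    Matrix.zero_apply, smul_eq_mul, ← Finset.mul_sum, mul_one] at h1
  -- Entries of E_0(E_i ∘ E_i) are, up to 1/|X|, column sums of squares of entries of E_i, so their
  -- vanishing forces E_i = 0.
  have h2 := (mul_eq_zero.1 h1).resolve_left (one_div_ne_zero hX)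
  rw [Finset.sum_eq_zero_iff_of_nonneg fun _ _ => mul_self_nonneg _] at h2
  exact mul_self_eq_zero.1 (h2 x (Finset.mem_univ x))

lemma krein_nonneg (i j k : Fin (d + 1)) : 0 ≤ e.krein i j k := by
  have := S.nonempty_points
  have hX : 0 < (Fintype.card X : ℝ) := by exact_mod_cast Fintype.card_pos
  have h := (e.posSemidef_E i).hadamard (e.posSemidef_E j)
  rw [e.hadamard_eq_sum_krein, Finset.smul_sum] at h
  simp only [smul_smul] at h
  exact nonneg_of_mul_nonneg_right (e.coeff_nonneg h k) (one_div_pos.2 hX)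

/-! ### Schur multiplication operators and Krein arrays. -/

/-- The matrix `A` represents Schur multiplication by `M` in the basis of minimal idempotents. -/
def Represents (M : Matrix X X ℝ) (A : Matrix (Fin (d + 1)) (Fin (d + 1)) ℝ) : Prop :=
  ∀ j, M ⊙ e.E j = ∑ k, A k j • e.E k

namespace Represents

variable {e} {M N : Matrix X X ℝ} {A B : Matrix (Fin (d + 1)) (Fin (d + 1)) ℝ}

lemma unique (hA : e.Represents M A) (hB : e.Represents M B) : A = B := by
  ext k j
  exact congrFun (e.coeff_unique ((hA j).symm.trans (hB j))) k

lemma allOnes : e.Represents (Matrix.of fun _ _ => 1) 1 := by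
  intro j
  rw [Finset.sum_eq_single j]
  · ext x y
    simp
  · intro k _ hk
    simp [one_apply_ne hk]
  · simp

lemma add (hA : e.Represents M A) (hB : e.Represents N B) : e.Represents (M + N) (A + B) := by
  intro j
  simp only [add_hadamard, hA j, hB j, Matrix.add_apply, add_smul, Finset.sum_add_distrib]

lemma smul (c : ℝ) (hA : e.Represents M A) : e.Represents (c • M) (c • A) := by
  intro j
  simp only [smul_hadamard, hA j, Matrix.smul_apply, smul_eq_mul, mul_smul, Finset.smul_sum]

lemma sum {ι : Type*} (s : Finset ι) {M : ι → Matrix X X ℝ}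
    {A : ι → Matrix (Fin (d + 1)) (Fin (d + 1)) ℝ} (h : ∀ i, e.Represents (M i) (A i)) :
    e.Represents (∑ i ∈ s, M i) (∑ i ∈ s, A i) := by
  classical
  induction s using Finset.induction_on with
  | empty => intro j; simp
  | insert a s ha ih =>
    rw [Finset.sum_insert ha, Finset.sum_insert ha]
    exact (h a).add ih

lemma hadamard (hA : e.Represents M A) (hB : e.Represents N B) :
    e.Represents (M ⊙ N) (A * B) := by
  intro j
  have h : ∀ c : Fin (d + 1) → ℝ, M ⊙ ∑ k, c k • e.E k = ∑ k, c k • (M ⊙ e.E k) := by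
    intro c
    ext x y
    simp only [hadamard_apply, Matrix.sum_apply, Matrix.smul_apply, smul_eq_mul, Finset.mul_sum]
    exact Finset.sum_congr rfl fun k _ => by ring
  rw [hadamard_assoc, hB j, h]
  simp only [hA _, Finset.smul_sum, smul_smul, mul_apply, Finset.sum_smul]
  rw [Finset.sum_comm]
  exact Finset.sum_congr rfl fun k _ => Finset.sum_congr rfl fun l _ => by rw [mul_comm]

lemma map_eval (hA : e.Represents M A) (p : ℝ[X]) :
    e.Represents (M.map fun t => p.eval t) (Polynomial.aeval A p) := by
  have hpow : ∀ n : ℕ, e.Represents (M.map fun t => t ^ n) (A ^ n) := by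
    intro n
    induction n with
    | zero => simpa using! allOnes (e := e)
    | succ n ih =>
      have h : (M.map fun t => t ^ (n + 1)) = (M.map fun t => t ^ n) ⊙ M := by
        ext x y
        simp [pow_succ]
      rw [h, pow_succ]
      exact ih.hadamard hA
  have h : (M.map fun t => p.eval t) =
      ∑ n ∈ p.support, p.coeff n • M.map fun t => t ^ n := by
    ext x y
    simp [eval_eq_sum, Polynomial.sum, Matrix.sum_apply]
  rw [h, aeval_def, eval₂_eq_sum, Polynomial.sum]
  simp only [← Algebra.smul_def]
  exact sum _ fun n => (hpow n).smul _

end Represents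

lemma represents_E (i : Fin (d + 1)) :
    e.Represents (e.E i) ((1 / (Fintype.card X : ℝ)) • e.kreinArray i) := by
  have := S.nonempty_points
  intro j
  rw [e.hadamard_eq_sum_krein, Finset.smul_sum]
  simp [kreinArray, smul_smul]

/-! ### Unit vectors attached to an idempotent. -/

lemma mult_pos (i : Fin (d + 1)) : 0 < e.mult i := by
  classical
  refine Nat.pos_of_ne_zero fun h => (e.minimal i).2.2.1 ?_
  obtain ⟨B, hB, -⟩ := exists_gram_of_isIdempotent (e.transpose_E i) (e.minimal i).2.1
  have : IsEmpty (Fin (e.E i).rank) := (show (e.E i).rank = 0 from h) ▸ Fin.isEmpty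
  rw [← hB]
  ext x y
  simp [mul_apply]

lemma exists_unit_gram (i : Fin (d + 1)) : ∃ u : X → Fin (e.mult i) → ℝ,
    ∀ x y, u x ⬝ᵥ u y = (((Fintype.card X : ℝ) / e.mult i) • e.E i) x y ∧ u x ⬝ᵥ u x = 1 := by
  classical
  have := S.nonempty_points
  have hX : 0 < (Fintype.card X : ℝ) := by exact_mod_cast Fintype.card_pos
  have hm : 0 < (e.mult i : ℝ) := by exact_mod_cast e.mult_pos i
  obtain ⟨B, hB, hB1⟩ := exists_gram_of_isIdempotent (e.transpose_E i) (e.minimal i).2.1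
  set c : ℝ := (Fintype.card X : ℝ) / e.mult i
  have hc : 0 ≤ c := by positivity
  -- The trace of BBᵀ equals that of BᵀB, the identity of size m_i.
  have htr : ∑ x, e.E i x x = e.mult i := by
    have h := trace_mul_comm B Bᵀ
    rw [hB, hB1, trace_one, Fintype.card_fin] at h
    exact h
  have hdiag : ∀ x, c * e.E i x x = 1 := by
    intro x
    rw [Finset.sum_congr rfl fun y _ => S.diag_eq_of_mem (e.minimal i).1 y x, Finset.sum_const,
      nsmul_eq_mul, Finset.card_univ] at htr
    rw [div_mul_eq_mul_div, htr, div_self hm.ne']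
  have hu : ∀ x y, (Real.sqrt c • B x) ⬝ᵥ (Real.sqrt c • B y) = c * e.E i x y := by
    intro x y
    rw [smul_dotProduct, dotProduct_smul, smul_smul, Real.mul_self_sqrt hc, smul_eq_mul]
    conv_rhs => rw [← hB]
    rfl
  exact ⟨fun x => Real.sqrt c • B x, fun x y => ⟨hu x y, (hu x x).trans (hdiag x)⟩⟩

/-- Schoenberg's theorem needs dimension at least 2; in degree 1 the polynomial is t, and E_i itself
is positive semidefinite. -/
lemma posSemidef_map_gegenbauer (i : Fin (d + 1)) (ℓ : ℕ) (h : ℓ = 1 ∨ 2 ≤ e.mult i) :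
    ((((Fintype.card X : ℝ) / (e.mult i : ℝ)) • e.E i).map
      (fun t => (gegenbauer (e.mult i) ℓ).eval t)).PosSemidef := by
  rcases h with rfl | h
  · have h1 : ((((Fintype.card X : ℝ) / (e.mult i : ℝ)) • e.E i).map
        (fun t => (gegenbauer (e.mult i) 1).eval t)) =
        ((Fintype.card X : ℝ) / (e.mult i : ℝ)) • e.E i := by
      ext x y
      simp [gegenbauer]
    rw [h1]
    exact (e.posSemidef_E i).smul (by positivity)
  · obtain ⟨u, hu⟩ := e.exists_unit_gram i
    have h1 := MvPolynomial.posSemidef_gegenbauer (σ := Fin (e.mult i))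
      (by rwa [Fintype.card_fin]) ℓ u fun x => (hu x x).2
    rw [Fintype.card_fin] at h1
    convert h1 using 1
    ext x y
    simp only [map_apply, Matrix.of_apply, (hu x y).1]

end IdempotentEnumeration

end SymmetricAssociationScheme

/-! ### The main theorem. -/

theorem mainTheorem3 {X : Type*} [Fintype X] [DecidableEq X] {d : ℕ}
    (S : SymmetricAssociationScheme X d) (e : S.IdempotentEnumeration) (i : Fin (d + 1)) :
    (∀ ℓ : ℕ, 0 < ℓ → (ℓ = 1 ∨ 2 ≤ e.mult i) →
      ∃ θ : Fin (d + 1) → ℝ,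
        (∀ j, 0 ≤ θ j) ∧
        ((((Fintype.card X : ℝ) / (e.mult i : ℝ)) • e.E i).map
            (fun t => (gegenbauer (e.mult i) ℓ).eval t) = ∑ j, θ j • e.E j) ∧
        (Polynomial.aeval ((1 / (e.mult i : ℝ)) • e.kreinArray i) (gegenbauer (e.mult i) ℓ) =
          (1 / (Fintype.card X : ℝ)) • ∑ j, θ j • e.kreinArray j) ∧
        (∀ μ : ℝ, Module.End.HasEigenvalue (Matrix.toLin'
            ((((Fintype.card X : ℝ) / (e.mult i : ℝ)) • e.E i).map
              (fun t => (gegenbauer (e.mult i) ℓ).eval t))) μ ↔ ∃ j, θ j = μ) ∧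
        (∀ j, θ j ≠ 0 →
          (∃ c : Fin (d + 1) → ℝ, ∑ k, c k • e.E k ∈ schurSubalgebra (e.E i) ∧ c j ≠ 0) ∧
          (∀ T : Set (Fin (d + 1)), i ∈ T →
            (∀ M ∈ Submodule.span ℝ (e.E '' T), ∀ N ∈ Submodule.span ℝ (e.E '' T),
              M ⊙ N ∈ Submodule.span ℝ (e.E '' T)) →
            j ∈ T))) ∧
    (∀ ℓ : ℕ, (ℓ ≤ 1 ∨ 2 ≤ e.mult i) → ∀ k j : Fin (d + 1),
      0 ≤ (Polynomial.aeval ((1 / (e.mult i : ℝ)) • e.kreinArray i)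
        (gegenbauer (e.mult i) ℓ)) k j) := by
  have := S.nonempty_points
  have hX : (Fintype.card X : ℝ) ≠ 0 := by exact_mod_cast Fintype.card_ne_zero
  have main : ∀ ℓ : ℕ, (ℓ = 1 ∨ 2 ≤ e.mult i) → ∃ θ : Fin (d + 1) → ℝ,
      (∀ j, 0 ≤ θ j) ∧
      ((((Fintype.card X : ℝ) / (e.mult i : ℝ)) • e.E i).map
        (fun t => (gegenbauer (e.mult i) ℓ).eval t) = ∑ j, θ j • e.E j) ∧
      (Polynomial.aeval ((1 / (e.mult i : ℝ)) • e.kreinArray i) (gegenbauer (e.mult i) ℓ) =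
        (1 / (Fintype.card X : ℝ)) • ∑ j, θ j • e.kreinArray j) := by
    intro ℓ h
    have hmem := schurSubalgebra_le S.allOnes_mem (e.minimal i).1
      (fun A hA B hB => S.hadamard_mem hA hB)
      (map_eval_mem_schurSubalgebra (e.E i) ((Fintype.card X : ℝ) / (e.mult i : ℝ))
        (gegenbauer (e.mult i) ℓ))
    obtain ⟨θ, hθ⟩ := e.exists_eq_sum hmem
    refine ⟨θ, e.coeff_nonneg (hθ ▸ e.posSemidef_map_gegenbauer i ℓ h), hθ, ?_⟩
    -- Both sides of the Krein array identity represent Schur multiplication by the same matrix, so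
    -- they agree by uniqueness.
    have h1 := ((e.represents_E i).smul ((Fintype.card X : ℝ) / (e.mult i : ℝ))).map_eval
      (gegenbauer (e.mult i) ℓ)
    have h2 := SymmetricAssociationScheme.IdempotentEnumeration.Represents.sum Finset.univ
      fun j => (e.represents_E j).smul (θ j)
    rw [hθ, smul_smul] at h1
    have hc : (Fintype.card X : ℝ) / (e.mult i : ℝ) * (1 / (Fintype.card X : ℝ)) =
        1 / (e.mult i : ℝ) := by field_simp
    rw [hc] at h1
    rw [h1.unique h2, Finset.smul_sum]
    exact Finset.sum_congr rfl fun j _ => smul_comm _ _ _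
  refine ⟨fun ℓ _ h => ?_, fun ℓ h k j => ?_⟩
  · obtain ⟨θ, hθ0, hθ, hL⟩ := main ℓ h
    have hmem := map_eval_mem_schurSubalgebra (e.E i) ((Fintype.card X : ℝ) / (e.mult i : ℝ))
      (gegenbauer (e.mult i) ℓ)
    rw [hθ] at hmem
    refine ⟨θ, hθ0, hθ, hL, fun μ => hθ ▸ e.hasEigenvalue_sum_iff θ μ, fun j hj =>
      ⟨⟨θ, hmem, hj⟩, fun T hi hT => ?_⟩⟩
    have hJ : (Matrix.of fun _ _ => 1 : Matrix X X ℝ) ∈ Submodule.span ℝ (e.E '' T) := by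
      have h0 := Submodule.smul_mem _ (Fintype.card X : ℝ)
        (Submodule.subset_span (R := ℝ)
          (Set.mem_image_of_mem e.E (e.zero_mem_of_schur_closed hi hT)))
      rwa [e.zero_eq, smul_smul, mul_one_div_cancel hX, one_smul] at h0
    by_contra hjT
    -- The span over T contains J and E_i, hence the whole Schur subalgebra of E_i; for j outside T,
    -- E_j would annihilate the matrix, yet their product is θ_j E_j.
    have h1 := e.E_mul_eq_zero_of_mem_span (schurSubalgebra_le hJ
      (Submodule.subset_span (Set.mem_image_of_mem e.E hi)) hT hmem) hjT
    rw [e.E_mul_sum] at h1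
    exact (smul_ne_zero hj (e.minimal j).2.2.1) h1
  · rcases Nat.eq_zero_or_pos ℓ with rfl | hℓ
    -- Degree 0 gives the identity matrix, whatever m_i is.
    · rw [gegenbauer, map_one, one_apply]
      split_ifs <;> norm_num
    · obtain ⟨θ, hθ0, -, hL⟩ := main ℓ (h.imp_left fun h => le_antisymm h hℓ)
      rw [hL, Matrix.smul_apply, Matrix.sum_apply]
      exact mul_nonneg (by positivity) (Finset.sum_nonneg fun l _ =>
        mul_nonneg (hθ0 l) (e.krein_nonneg l j k))
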